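/- For a finite sequence of positive integers $\mathbf{s}=(s_1,\dots,s_l)$, with $l=0$ or $s_l>1$, let $$t(s_1,\dots,s_l)=\sum_{1\le k_1<k_2<\cdots<k_l}\frac{1}{(2k_1-1)^{s_1}(2k_2-1)^{s_2}\cdots(2k_l-1)^{s_l}}$$ be the multiple $t$-value, where $t(\emptyset)=1$ for the empty sequence, and let $\{2\}^d$ denote the sequence consisting of $d$ entries equal to $2$. Let $\zeta$ be the Riemann zeta function. For all integers $r,s\ge 0$ put $T(r,s)=t(\{2\}^r,3,\{2\}^s)$, and for $k\ge 1$ put $$d^{(k)}_{r,s}=\binom{2k}{2r+1}+\Bigl(1-\frac{1}{2^{2k}}\Bigr)\binom{2k}{2s+1}.$$ Then for all integers $r,s\ge 0$ the series defining $T(r,s)$ and $t(\{2\}^{r+s+1-k})$, $1\le k\le r+s+1$, converge, and $$T(r,s)=\sum_{k=1}^{r+s+1}(-1)^{k-1}\,d^{(k)}_{r,s}\,\frac{1}{2^{2k}}\,\zeta(2k+1)\,t\bigl(\{2\}^{r+s+1-k}\bigr).$$ -/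

import Mathlib

/-- The range of summation of a multiple `t`-value of depth `l`:
tuples of integers with `1 ≤ k₁ < k₂ < ⋯ < k_l`. -/
def IncreasingTuple (l : ℕ) : Type :=
  {k : Fin l → ℕ // (∀ i, 1 ≤ k i) ∧ StrictMono k}

/-- The summand `1 / ((2k₁-1)^{s₁} ⋯ (2k_l-1)^{s_l})`, for an index `s = (s₁, …, s_l)`. -/
noncomputable def tTerm (s : List ℕ) (k : IncreasingTuple s.length) : ℝ :=
  ∏ i : Fin s.length, 1 / (2 * (k.1 i : ℝ) - 1) ^ s.get i

/-- The multiple `t`-value `t(s₁, …, s_l)`. For the empty index the sum has exactly one term,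
the empty product, so that `t(∅) = 1`. -/
noncomputable def multipleT (s : List ℕ) : ℝ :=
  ∑' k : IncreasingTuple s.length, tTerm s k

/-- The index `{2}^d`. -/
def twos (d : ℕ) : List ℕ := List.replicate d 2

/-- The index `({2}^r, 3, {2}^s)`. -/
def twosThreeTwos (r s : ℕ) : List ℕ := twos r ++ 3 :: twos s

/-- `T(r,s) = t({2}^r, 3, {2}^s)`. -/
noncomputable def T (r s : ℕ) : ℝ := multipleT (twosThreeTwos r s)

/-- The coefficient `d^{(k)}_{r,s}`. -/
noncomputable def dCoeff (k r s : ℕ) : ℝ :=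
  (Nat.choose (2 * k) (2 * r + 1) : ℝ)
    + (1 - 1 / 2 ^ (2 * k)) * (Nat.choose (2 * k) (2 * s + 1) : ℝ)

open scoped ENNReal Nat Topology
open Filter MeasureTheory Real

/-! ### Reduction of the multiple sums to iterated sums -/

/-! Both kinds of series are evaluated by telescoping in the lower summation bound `N`. For w_n =
∫_0^{π/2} cos^{2n+1}, let K_j(N, ψ) be the moment of (t-ψ)^j/j! against cos^{2N-1} on [ψ, π/2],
divided by w_{N-1}. Two integrations by parts give K_{j+2}(N) - K_{j+2}(N+1) = K_j(N+1)/(2N+1)^2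
(`cosKernel_sub_succ`), so prepending an entry 2 raises j by 2. Since K_0(N, 0) = 1, this gives
`tailSum_twos`, and at N = 0 the value t({2}^d) = (π/2)^{2d}/(2d)!.

The extra factor 1/(2n+1) of the entry 3 is absorbed by an integration by parts that introduces the
weight tan ψ (`ofReal_cosKernel_div`). The series then telescopes under the integral to K_1, and r
further entries 2 give K_{2r+1}. At N = 0 this is a polynomial in ψ, and u = π/2 - ψ yields T(r,s) =
∫_0^{π/2} P(u) cot u du with P(u) = u^{2r+1}(π/2-u)^{2s+1}/((2r+1)!(2s+1)!).

Finally cot u is replaced by 2 Σ sin 2ku, justified by Riemann–Lebesgue. Integrating by parts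
against P leaves even derivatives of P at 0 and π/2, multiplied by ζ(2j+1) and its alternating
analogue (`integral_eval_div_sin_mul_cos`). These derivatives are binomial coefficients times values
t({2}^d). -/

/-- The sum of `∏ 1 / (2kᵢ-1)^{sᵢ}` over `N < k₁ < k₂ < ⋯`, with values in `[0, ∞]`. -/
noncomputable def tailSum : List ℕ → ℕ → ℝ≥0∞
  | [], _ => 1
  | a :: s, N => ∑' i : ℕ, ENNReal.ofReal (1 / (2 * ((N + i : ℕ) : ℝ) + 1) ^ a) *
      tailSum s (N + i + 1)

theorem strictMono_cons_iff {l N a : ℕ} (k : Fin l → ℕ) :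
    ((∀ i, N < (Fin.cons a k : Fin (l + 1) → ℕ) i) ∧
      StrictMono (Fin.cons a k : Fin (l + 1) → ℕ)) ↔
      N < a ∧ (∀ i, a < k i) ∧ StrictMono k := by
  constructor
  · rintro ⟨h1, h2⟩
    refine ⟨by simpa using h1 0, fun i => ?_, fun i j hij => ?_⟩
    · simpa using h2 (Fin.succ_pos i)
    · simpa using h2 (Fin.succ_lt_succ_iff.2 hij)
  · rintro ⟨h1, h2, h3⟩
    refine ⟨fun i => ?_, fun i j hij => ?_⟩
    · refine Fin.cases ?_ (fun i => ?_) i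
      · simpa using h1
      · simpa using h1.trans (h2 i)
    · induction j using Fin.cases with
      | zero => exact absurd hij (Fin.not_lt_zero _)
      | succ j =>
        induction i using Fin.cases with
        | zero => simpa using h2 j
        | succ i => simpa using h3 (Fin.succ_lt_succ_iff.1 hij)

-- Extending the summand by zero to all functions makes the index set a product, so `Fin.consEquiv`
-- splits off the smallest index; in [0, ∞] this needs no summability.
open scoped Classical in
theorem tsum_ite_strictMono_eq_tailSum (s : List ℕ) (N : ℕ) :
    ∑' k : Fin s.length → ℕ, (if (∀ i, N < k i) ∧ StrictMono k then
      ENNReal.ofReal (∏ i, 1 / (2 * (k i : ℝ) - 1) ^ s.get i) else 0) = tailSum s N := by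
  induction s generalizing N with
  | nil =>
    have : Unique (Fin ([] : List ℕ).length → ℕ) :=
      inferInstanceAs (Unique (Fin 0 → ℕ))
    rw [tsum_fintype, Fintype.sum_unique, if_pos]
    · simp [tailSum]
    · exact ⟨fun i => i.elim0, fun i => i.elim0⟩
  | cons a s ih =>
    have hinj : Function.Injective (fun i : ℕ => N + i + 1) := fun i j h => by
      simpa using h
    have key : ∀ b : ℕ, ∑' k : Fin s.length → ℕ,
        (if (∀ i, N < (Fin.cons b k : Fin (s.length + 1) → ℕ) i) ∧
            StrictMono (Fin.cons b k : Fin (s.length + 1) → ℕ) then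
          ENNReal.ofReal (∏ i : Fin (s.length + 1),
            1 / (2 * (((Fin.cons b k : Fin (s.length + 1) → ℕ) i : ℕ) : ℝ) - 1) ^ (a :: s).get i)
          else 0) =
        if N < b then ENNReal.ofReal (1 / (2 * (b : ℝ) - 1) ^ a) * tailSum s b else 0 := by
      intro b
      by_cases hb : N < b
      · have hb1 : (1 : ℝ) ≤ b := by exact_mod_cast (show 1 ≤ b by omega)
        rw [if_pos hb, ← ih b, ← ENNReal.tsum_mul_left]
        refine tsum_congr fun k => ?_
        have hiff := strictMono_cons_iff (N := N) (a := b) k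
        by_cases hk : (∀ i, b < k i) ∧ StrictMono k
        · rw [if_pos (hiff.2 ⟨hb, hk⟩), if_pos hk, Fin.prod_univ_succ, ENNReal.ofReal_mul]
          · simp
          · simp only [Fin.cons_zero]
            have : 0 ≤ 2 * (b : ℝ) - 1 := by linarith
            positivity
        · rw [if_neg (fun h => hk (hiff.1 h).2), if_neg hk, mul_zero]
      · rw [if_neg hb]
        refine ENNReal.tsum_eq_zero.2 fun k => if_neg ?_
        rw [strictMono_cons_iff]
        exact fun h => hb h.1
    have step : ∑' k : Fin (s.length + 1) → ℕ, (if (∀ i, N < k i) ∧ StrictMono k then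
        ENNReal.ofReal (∏ i : Fin (s.length + 1), 1 / (2 * (k i : ℝ) - 1) ^ (a :: s).get i)
          else 0) = tailSum (a :: s) N := by
      rw [← (Fin.consEquiv (fun _ : Fin (s.length + 1) => ℕ)).tsum_eq, ENNReal.tsum_prod']
      refine (tsum_congr key).trans ?_
      rw [← hinj.tsum_eq]
      · rw [tailSum]
        refine tsum_congr fun i => ?_
        rw [if_pos (by omega)]
        congr 4
        push_cast
        ring
      · intro b hb
        have : N < b := by
          by_contra h
          simp [h] at hb
        exact ⟨b - N - 1, by simp only; omega⟩
    exact step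

theorem tTerm_nonneg (s : List ℕ) (k : IncreasingTuple s.length) : 0 ≤ tTerm s k := by
  refine Finset.prod_nonneg fun i _ => ?_
  have h : (1 : ℝ) ≤ k.1 i := by exact_mod_cast k.2.1 i
  have : 0 ≤ 2 * (k.1 i : ℝ) - 1 := by linarith
  positivity

theorem tsum_ofReal_tTerm (s : List ℕ) :
    ∑' k : IncreasingTuple s.length, ENNReal.ofReal (tTerm s k) = tailSum s 0 := by
  classical
  rw [← tsum_ite_strictMono_eq_tailSum]
  have := tsum_subtype {k : Fin s.length → ℕ | (∀ i, 1 ≤ k i) ∧ StrictMono k}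
    (fun k => ENNReal.ofReal (∏ i, 1 / (2 * (k i : ℝ) - 1) ^ s.get i))
  refine this.trans (tsum_congr fun k => ?_)
  rw [Set.indicator_apply]
  rfl

theorem summable_tTerm_and_multipleT_eq {s : List ℕ} {x : ℝ} (hx : 0 ≤ x)
    (h : tailSum s 0 = ENNReal.ofReal x) : Summable (tTerm s) ∧ multipleT s = x := by
  have hs := tsum_ofReal_tTerm s
  have hne : ∑' k : IncreasingTuple s.length, ENNReal.ofReal (tTerm s k) ≠ ∞ := by
    rw [hs, h]; exact ENNReal.ofReal_ne_top
  have hsum : Summable (tTerm s) := by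
    refine (ENNReal.summable_toReal hne).congr fun k => ?_
    exact ENNReal.toReal_ofReal (tTerm_nonneg s k)
  refine ⟨hsum, ?_⟩
  rw [multipleT, ← ENNReal.ofReal_eq_ofReal_iff (tsum_nonneg (tTerm_nonneg s)) hx, ← h, ← hs,
    ENNReal.ofReal_tsum_of_nonneg (tTerm_nonneg s) hsum]

/-! ### Moments of powers of the cosine -/

noncomputable def cosMoment (n : ℕ) : ℝ := ∫ x in (0 : ℝ)..π / 2, cos x ^ (2 * n + 1)

theorem cosMoment_zero : cosMoment 0 = 1 := by
  simp [cosMoment]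

theorem cosMoment_succ (n : ℕ) :
    cosMoment (n + 1) = (2 * n + 2) / (2 * n + 3) * cosMoment n := by
  have h := integral_cos_pow (a := 0) (b := π / 2) (2 * n + 1)
  rw [cosMoment, cosMoment, show 2 * (n + 1) + 1 = 2 * n + 1 + 2 by ring, h]
  simp only [cos_pi_div_two, sin_zero]
  push_cast
  ring

theorem cosMoment_pos (n : ℕ) : 0 < cosMoment n := by
  induction n with
  | zero => simp [cosMoment_zero]
  | succ n ih => rw [cosMoment_succ]; positivity

/-- The induction step is (2n+1)(2n+3) ≤ (2n+2)^2. Only the order n^{-1/2} matters, for the decay of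
`cosKernel`. -/
theorem inv_le_cosMoment_sq (n : ℕ) : 1 / (2 * n + 1 : ℝ) ≤ cosMoment n ^ 2 := by
  induction n with
  | zero => simp [cosMoment_zero]
  | succ n ih =>
    rw [cosMoment_succ, mul_pow]
    refine le_trans ?_ (mul_le_mul_of_nonneg_left ih (by positivity))
    rw [div_pow, div_mul_div_comm, div_le_div_iff₀ (by positivity) (by positivity)]
    push_cast
    have : (0 : ℝ) ≤ n := n.cast_nonneg
    nlinarith

/-- The normalised truncated moments `(∫_ψ^{π/2} cos^{2N-1}(t) (t-ψ)^j / j! dt) / (∫ cos^{2N-1})`;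
the value at `N = 0` is the one that makes the recursion in `N` hold there. -/
noncomputable def cosKernel (j : ℕ) : ℕ → ℝ → ℝ
  | 0, ψ => (π / 2 - ψ) ^ j / j !
  | n + 1, ψ => (∫ t in ψ..π / 2, cos t ^ (2 * n + 1) * ((t - ψ) ^ j / j !)) / cosMoment n

theorem cosKernel_zero_zero (N : ℕ) : cosKernel 0 N 0 = 1 := by
  cases N with
  | zero => simp [cosKernel]
  | succ n =>
    have := (cosMoment_pos n).ne'
    simp only [cosKernel, pow_zero, Nat.factorial_zero, Nat.cast_one, div_one, mul_one]
    exact div_self this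

theorem cosKernel_nonneg (j N : ℕ) {ψ : ℝ} (h0 : 0 ≤ ψ) (h1 : ψ ≤ π / 2) :
    0 ≤ cosKernel j N ψ := by
  cases N with
  | zero => have : 0 ≤ π / 2 - ψ := by linarith
            simp only [cosKernel]; positivity
  | succ n =>
    refine div_nonneg (intervalIntegral.integral_nonneg h1 fun t ht => ?_) (cosMoment_pos n).le
    have h2 : 0 ≤ cos t := cos_nonneg_of_mem_Icc ⟨by linarith [ht.1, pi_pos], ht.2⟩
    have h3 : 0 ≤ t - ψ := by linarith [ht.1]
    positivity

theorem continuous_cosKernel (j N : ℕ) : Continuous (cosKernel j N) := by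
  cases N with
  | zero => unfold cosKernel; fun_prop
  | succ n =>
    have h : Continuous fun ψ : ℝ =>
        ∫ t in π / 2..ψ, cos t ^ (2 * n + 1) * ((t - ψ) ^ j / (j ! : ℝ)) :=
      intervalIntegral.continuous_parametric_intervalIntegral_of_continuous
        (f := fun ψ t => cos t ^ (2 * n + 1) * ((t - ψ) ^ j / (j ! : ℝ)))
        (by unfold Function.uncurry; fun_prop) continuous_id
    have : cosKernel j (n + 1) = fun ψ =>
        -(∫ t in π / 2..ψ, cos t ^ (2 * n + 1) * ((t - ψ) ^ j / (j ! : ℝ))) / cosMoment n := by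
      funext ψ
      rw [cosKernel, intervalIntegral.integral_symm]
    rw [this]
    exact h.neg.div_const _

theorem hasDerivAt_sub_pow_div_factorial (j : ℕ) (ψ t : ℝ) :
    HasDerivAt (fun x => (x - ψ) ^ (j + 1) / ((j + 1)! : ℝ)) ((t - ψ) ^ j / j !) t := by
  have h := (((hasDerivAt_id t).sub_const ψ).pow (j + 1)).div_const ((j + 1)! : ℝ)
  refine h.congr_deriv ?_
  have h1 : (j ! : ℝ) ≠ 0 := by positivity
  have h2 : ((j : ℝ) + 1) ≠ 0 := by positivity
  simp only [id, Nat.add_sub_cancel, Nat.factorial_succ]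
  push_cast
  field_simp

/-- The left side integrates p against the second derivative of cos^{n+2}; both derivatives are
moved onto p, and the boundary terms at π/2 vanish with the cosine. -/
theorem integral_cos_pow_mul_by_parts {p q s : ℝ → ℝ} (hp : ∀ x, HasDerivAt p (q x) x)
    (hq : ∀ x, HasDerivAt q (s x) x) (hs : Continuous s) (n : ℕ) (ψ : ℝ) :
    (n + 2) * (n + 1) * (∫ t in ψ..π / 2, cos t ^ n * p t)
        - (n + 2) ^ 2 * (∫ t in ψ..π / 2, cos t ^ (n + 2) * p t)
      = (∫ t in ψ..π / 2, cos t ^ (n + 2) * s t)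
        + (n + 2) * cos ψ ^ (n + 1) * sin ψ * p ψ + cos ψ ^ (n + 2) * q ψ := by
  have hpc : Continuous p := continuous_iff_continuousAt.2 fun x => (hp x).continuousAt
  have hqc : Continuous q := continuous_iff_continuousAt.2 fun x => (hq x).continuousAt
  have hF : ∀ x ∈ Set.uIcc ψ (π / 2),
      HasDerivAt (fun x => -((n + 2) * cos x ^ (n + 1) * sin x * p x) - cos x ^ (n + 2) * q x)
        ((n + 2) * (n + 1) * (cos x ^ n * p x) - (n + 2) ^ 2 * (cos x ^ (n + 2) * p x)
          - cos x ^ (n + 2) * s x) x := by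
    intro x _
    have h1 := (((((hasDerivAt_cos x).pow (n + 1)).const_mul ((n : ℝ) + 2)).mul
      (hasDerivAt_sin x)).mul (hp x)).neg.sub (((hasDerivAt_cos x).pow (n + 2)).mul (hq x))
    refine h1.congr_deriv ?_
    simp only [Pi.mul_apply, Pi.pow_apply, Nat.add_sub_cancel,
      show n + 2 - 1 = n + 1 by omega]
    push_cast
    have hsq : sin x * sin x = 1 - cos x ^ 2 := by nlinarith [sin_sq_add_cos_sq x]
    linear_combination ((n : ℝ) + 2) * (n + 1) * cos x ^ n * p x * hsq
  have h := intervalIntegral.integral_eq_sub_of_hasDerivAt hF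
    (Continuous.intervalIntegrable (by fun_prop) _ _)
  rw [intervalIntegral.integral_sub, intervalIntegral.integral_sub,
    intervalIntegral.integral_const_mul, intervalIntegral.integral_const_mul] at h
  · simp only [cos_pi_div_two] at h
    have e1 : (0 : ℝ) ^ (n + 1) = 0 := by simp
    have e2 : (0 : ℝ) ^ (n + 2) = 0 := by simp
    rw [e1, e2] at h
    linear_combination h
  all_goals exact Continuous.intervalIntegrable (by fun_prop) _ _

/-- The analogue for exponent 1, where the boundary term at π/2 survives. It accounts for the
separate value of `cosKernel` at N = 0. -/
theorem integral_cos_mul_by_parts {p q s : ℝ → ℝ} (hp : ∀ x, HasDerivAt p (q x) x)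
    (hq : ∀ x, HasDerivAt q (s x) x) (hs : Continuous s) (ψ : ℝ) :
    p (π / 2) = (∫ t in ψ..π / 2, cos t * p t) + (∫ t in ψ..π / 2, cos t * s t)
      + sin ψ * p ψ + cos ψ * q ψ := by
  have hpc : Continuous p := continuous_iff_continuousAt.2 fun x => (hp x).continuousAt
  have hF : ∀ x ∈ Set.uIcc ψ (π / 2),
      HasDerivAt (fun x => sin x * p x + cos x * q x) (cos x * p x + cos x * s x) x := by
    intro x _
    refine (((hasDerivAt_sin x).mul (hp x)).add ((hasDerivAt_cos x).mul (hq x))).congr_deriv ?_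
    ring
  have h := intervalIntegral.integral_eq_sub_of_hasDerivAt hF
    (Continuous.intervalIntegrable (by fun_prop) _ _)
  rw [intervalIntegral.integral_add] at h
  · simp only [cos_pi_div_two, sin_pi_div_two] at h
    linear_combination -h
  all_goals exact Continuous.intervalIntegrable (by fun_prop) _ _

theorem cosKernel_sub_succ (j N : ℕ) (ψ : ℝ) :
    cosKernel (j + 2) N ψ - cosKernel (j + 2) (N + 1) ψ
      = cosKernel j (N + 1) ψ / (2 * N + 1) ^ 2 := by
  have hp : ∀ t, HasDerivAt (fun x => (x - ψ) ^ (j + 2) / ((j + 2)! : ℝ))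
      ((t - ψ) ^ (j + 1) / ((j + 1)! : ℝ)) t := hasDerivAt_sub_pow_div_factorial (j + 1) ψ
  have hq := hasDerivAt_sub_pow_div_factorial j ψ
  have hs : Continuous fun t => (t - ψ) ^ j / (j ! : ℝ) := by fun_prop
  cases N with
  | zero =>
    have h := integral_cos_mul_by_parts hp hq hs ψ
    rw [sub_self, zero_pow (by omega), zero_pow (by omega)] at h
    simp only [cosKernel, cosMoment_zero, mul_zero, zero_add, pow_one, div_one, Nat.cast_zero,
      one_pow, zero_div, add_zero] at h ⊢
    linear_combination h
  | succ n =>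
    have h := integral_cos_pow_mul_by_parts hp hq hs (2 * n + 1) ψ
    have hw := (cosMoment_pos n).ne'
    have hn : (2 * n + 3 : ℝ) ≠ 0 := by positivity
    have hn' : (2 * n + 2 : ℝ) ≠ 0 := by positivity
    -- For exponent j + 2 both p and p' vanish at ψ, so no boundary term remains.
    rw [sub_self, zero_pow (by omega), zero_pow (by omega)] at h
    simp only [cosKernel, cosMoment_succ, show 2 * (n + 1) + 1 = 2 * n + 1 + 2 by ring]
    push_cast at h ⊢
    rw [show (2 * (n : ℝ) + 1 + 2) = 2 * n + 3 by ring,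
      show (2 * (n : ℝ) + 1 + 1) = 2 * n + 2 by ring] at h
    rw [show (2 * ((n : ℝ) + 1) + 1) = 2 * n + 3 by ring]
    generalize (∫ t in ψ..π / 2, cos t ^ (2 * n + 1) * ((t - ψ) ^ (j + 2) / ((j + 2)! : ℝ))) = I
      at h ⊢
    generalize (∫ t in ψ..π / 2, cos t ^ (2 * n + 1 + 2) * ((t - ψ) ^ (j + 2) / ((j + 2)! : ℝ)))
      = I' at h ⊢
    generalize (∫ t in ψ..π / 2, cos t ^ (2 * n + 1 + 2) * ((t - ψ) ^ j / (j ! : ℝ))) = J at h ⊢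
    field_simp
    linear_combination h

/-- Here p = t - ψ is linear: p'' = 0 kills the integral, while p'(ψ) = 1 leaves the boundary power
of the cosine. -/
theorem cosKernel_one_sub_succ (N : ℕ) (ψ : ℝ) :
    cosKernel 1 N ψ - cosKernel 1 (N + 1) ψ
      = cos ψ ^ (2 * N + 1) / cosMoment N / (2 * N + 1) ^ 2 := by
  have hp : ∀ x, HasDerivAt (fun x => (x - ψ) ^ 1 / (1 ! : ℝ)) 1 x := fun x => by
    simpa using hasDerivAt_sub_pow_div_factorial 0 ψ x
  have hq : ∀ x : ℝ, HasDerivAt (fun _ => (1 : ℝ)) 0 x := fun x => hasDerivAt_const x 1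
  have hs : Continuous fun _ : ℝ => (0 : ℝ) := continuous_const
  cases N with
  | zero =>
    have h := integral_cos_mul_by_parts hp hq hs ψ
    simp only [cosKernel, cosMoment_zero, mul_zero, zero_add, pow_one, div_one, Nat.cast_zero,
      one_pow, sub_self, zero_div, add_zero, mul_zero, intervalIntegral.integral_zero] at h ⊢
    linear_combination h
  | succ n =>
    have h := integral_cos_pow_mul_by_parts hp hq hs (2 * n + 1) ψ
    have hw := (cosMoment_pos n).ne'
    have hn : (2 * n + 3 : ℝ) ≠ 0 := by positivity
    have hn' : (2 * n + 2 : ℝ) ≠ 0 := by positivity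
    simp only [sub_self, mul_zero, intervalIntegral.integral_zero] at h
    simp only [cosKernel, cosMoment_succ, show 2 * (n + 1) + 1 = 2 * n + 1 + 2 by ring]
    push_cast at h ⊢
    rw [show (2 * (n : ℝ) + 1 + 2) = 2 * n + 3 by ring,
      show (2 * (n : ℝ) + 1 + 1) = 2 * n + 2 by ring] at h
    rw [show (2 * ((n : ℝ) + 1) + 1) = 2 * n + 3 by ring]
    generalize (∫ t in ψ..π / 2, cos t ^ (2 * n + 1) * ((t - ψ) ^ 1 / (1 ! : ℝ))) = I at h ⊢
    generalize (∫ t in ψ..π / 2, cos t ^ (2 * n + 1 + 2) * ((t - ψ) ^ 1 / (1 ! : ℝ))) = I' at h ⊢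
    field_simp
    linear_combination h

/-- One factor of t is traded for sin t by Jordan's inequality, making the majorant an exact
derivative of size 1/n, which beats w_n ≥ (2n+1)^{-1/2}. This requires a positive exponent: for
exponent 0 the kernel at ψ = 0 is constantly 1. -/
theorem cosKernel_succ_le (j n : ℕ) {ψ : ℝ} (h0 : 0 ≤ ψ) (h1 : ψ ≤ π / 2) :
    cosKernel (j + 1) (n + 1) ψ ≤ (π / 2) ^ (j + 1) / √(2 * n + 1) := by
  have hI : ∫ t in ψ..π / 2, cos t ^ (2 * n + 1) * ((t - ψ) ^ (j + 1) / ((j + 1)! : ℝ))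
      ≤ (π / 2) ^ (j + 1) / (2 * n + 1) := by
    have hF : ∀ x ∈ Set.uIcc ψ (π / 2),
        HasDerivAt (fun x => -((π / 2) ^ (j + 1) / (2 * n + 2) * cos x ^ (2 * n + 2)))
          ((π / 2) ^ (j + 1) * (cos x ^ (2 * n + 1) * sin x)) x := by
      intro x _
      refine (((hasDerivAt_cos x).pow (2 * n + 2)).const_mul
        ((π / 2) ^ (j + 1) / (2 * (n : ℝ) + 2))).neg.congr_deriv ?_
      have : (2 * n + 2 : ℝ) ≠ 0 := by positivity
      rw [show 2 * n + 2 - 1 = 2 * n + 1 by omega]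
      push_cast
      field_simp
    have h := intervalIntegral.integral_eq_sub_of_hasDerivAt hF
      (Continuous.intervalIntegrable (by fun_prop) _ _)
    refine (intervalIntegral.integral_mono_on h1
      (Continuous.intervalIntegrable (by fun_prop) _ _)
      (g := fun x => (π / 2) ^ (j + 1) * (cos x ^ (2 * n + 1) * sin x))
      (Continuous.intervalIntegrable (by fun_prop) _ _) fun t ht => ?_).trans ?_
    · have ht0 : 0 ≤ t := h0.trans ht.1
      have h2 : 0 ≤ cos t := cos_nonneg_of_mem_Icc ⟨by linarith [pi_pos], ht.2⟩
      have h3 : 0 ≤ t - ψ := by linarith [ht.1]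
      have h4 : t ≤ π / 2 * sin t := by
        have := mul_le_sin ht0 ht.2
        calc t = π / 2 * (2 / π * t) := by field_simp
          _ ≤ _ := by gcongr
      have h5 : (t - ψ) ^ (j + 1) / ((j + 1)! : ℝ) ≤ (π / 2) ^ (j + 1) * sin t := by
        refine (div_le_self (by positivity) ?_).trans ?_
        · exact_mod_cast Nat.one_le_iff_ne_zero.2 (Nat.factorial_ne_zero _)
        · rw [pow_succ, pow_succ, mul_assoc]
          have : t - ψ ≤ π / 2 := by linarith [ht.2]
          gcongr
          linarith
      calc _ ≤ cos t ^ (2 * n + 1) * ((π / 2) ^ (j + 1) * sin t) := by gcongr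
        _ = _ := by ring
    · rw [h, cos_pi_div_two, zero_pow (by omega)]
      have h2 : 0 ≤ cos ψ := cos_nonneg_of_mem_Icc ⟨by linarith [pi_pos], h1⟩
      have h3 : cos ψ ^ (2 * n + 2) ≤ 1 := pow_le_one₀ h2 (cos_le_one ψ)
      calc _ = (π / 2) ^ (j + 1) / (2 * n + 2) * cos ψ ^ (2 * n + 2) := by ring
        _ ≤ (π / 2) ^ (j + 1) / (2 * n + 2) * 1 := by gcongr
        _ ≤ _ := by rw [mul_one]; gcongr; norm_num
  have hw : 1 / √(2 * n + 1 : ℝ) ≤ cosMoment n := by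
    refine le_of_sq_le_sq ?_ (cosMoment_pos n).le
    rw [div_pow, one_pow, sq_sqrt (by positivity)]
    exact inv_le_cosMoment_sq n
  have hs : 0 < √(2 * n + 1 : ℝ) := by positivity
  rw [cosKernel, div_le_iff₀ (cosMoment_pos n)]
  refine hI.trans ?_
  calc (π / 2) ^ (j + 1) / (2 * n + 1) = (π / 2) ^ (j + 1) / √(2 * n + 1) * (1 / √(2 * n + 1)) := by
        rw [div_mul_div_comm, mul_one, mul_self_sqrt (by positivity)]
    _ ≤ _ := by gcongr

theorem tendsto_cosKernel (j : ℕ) {ψ : ℝ} (h0 : 0 ≤ ψ) (h1 : ψ ≤ π / 2) :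
    Tendsto (fun N => cosKernel (j + 1) N ψ) atTop (𝓝 0) := by
  refine (tendsto_add_atTop_iff_nat 1).1 ?_
  refine squeeze_zero (fun n => cosKernel_nonneg _ _ h0 h1)
    (fun n => cosKernel_succ_le j n h0 h1) ?_
  refine Tendsto.const_div_atTop ?_ _
  refine tendsto_sqrt_atTop.comp ?_
  exact tendsto_atTop_add_const_right _ _
    (tendsto_natCast_atTop_atTop.const_mul_atTop (by norm_num))

/-! ### Tail sums by telescoping -/

theorem tsum_ofReal_eq_of_telescoping {K f : ℕ → ℝ} (hf : ∀ n, 0 ≤ f n)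
    (h : ∀ n, K n - K (n + 1) = f n) (hK : Tendsto K atTop (𝓝 0)) (N : ℕ) :
    ∑' i, ENNReal.ofReal (f (N + i)) = ENNReal.ofReal (K N) := by
  have hs : HasSum (fun i => f (N + i)) (K N) := by
    rw [hasSum_iff_tendsto_nat_of_nonneg fun i => hf _]
    have : ∀ n, ∑ i ∈ Finset.range n, f (N + i) = K N - K (n + N) := fun n => by
      simp_rw [← h]
      exact (Finset.sum_range_sub' (fun i => K (N + i)) n).trans (by rw [add_zero, add_comm n N])
    simp_rw [this]
    simpa using ((tendsto_add_atTop_iff_nat N).2 hK).const_sub (K N)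
  rw [← ENNReal.ofReal_tsum_of_nonneg (fun i => hf _) hs.summable, hs.tsum_eq]

theorem tailSum_twos (s N : ℕ) :
    tailSum (twos s) N = ENNReal.ofReal (cosKernel (2 * s) N 0) := by
  induction s generalizing N with
  | zero => simp [twos, tailSum, cosKernel_zero_zero]
  | succ s ih =>
    have hpi : (0 : ℝ) ≤ π / 2 := by positivity
    have h := tsum_ofReal_eq_of_telescoping
      (K := fun N => cosKernel (2 * s + 2) N 0)
      (f := fun N => cosKernel (2 * s) (N + 1) 0 / (2 * N + 1) ^ 2)
      (fun n => div_nonneg (cosKernel_nonneg _ _ le_rfl hpi) (by positivity))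
      (fun n => cosKernel_sub_succ _ n 0) (tendsto_cosKernel (2 * s + 1) le_rfl hpi) N
    rw [show 2 * (s + 1) = 2 * s + 2 by ring, ← h]
    change tailSum (2 :: twos s) N = _
    rw [tailSum]
    refine tsum_congr fun i => ?_
    rw [ih, ← ENNReal.ofReal_mul (by positivity), one_div_mul_eq_div]

theorem multipleT_twos (d : ℕ) :
    Summable (tTerm (twos d)) ∧ multipleT (twos d) = (π / 2) ^ (2 * d) / (2 * d)! := by
  refine summable_tTerm_and_multipleT_eq (by positivity) ?_
  rw [tailSum_twos, cosKernel, sub_zero]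

/-- Tonelli in [0, ∞] moves the sum inside the weighted integral, where it telescopes pointwise. -/
theorem tsum_mul_lintegral_of_telescoping {h : ℝ → ℝ} {K f : ℕ → ℝ → ℝ} (hh : Measurable h)
    (hfm : ∀ n, Measurable (f n)) (hf : ∀ n, ∀ ψ ∈ Set.Ioo 0 (π / 2), 0 ≤ f n ψ)
    (hK : ∀ n ψ, K n ψ - K (n + 1) ψ = f n ψ / (2 * n + 1) ^ 2)
    (hlim : ∀ ψ ∈ Set.Ioo 0 (π / 2), Tendsto (fun n => K n ψ) atTop (𝓝 0)) (N : ℕ) :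
    ∑' i : ℕ, ENNReal.ofReal (1 / (2 * ((N + i : ℕ) : ℝ) + 1) ^ 2) *
      ∫⁻ ψ in Set.Ioo 0 (π / 2), ENNReal.ofReal (h ψ) * ENNReal.ofReal (f (N + i) ψ)
      = ∫⁻ ψ in Set.Ioo 0 (π / 2), ENNReal.ofReal (h ψ) * ENNReal.ofReal (K N ψ) := by
  have e : ∀ i : ℕ, ENNReal.ofReal (1 / (2 * ((N + i : ℕ) : ℝ) + 1) ^ 2) *
      ∫⁻ ψ in Set.Ioo 0 (π / 2), ENNReal.ofReal (h ψ) * ENNReal.ofReal (f (N + i) ψ)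
      = ∫⁻ ψ in Set.Ioo 0 (π / 2), ENNReal.ofReal (h ψ) *
        ENNReal.ofReal (f (N + i) ψ / (2 * ((N + i : ℕ) : ℝ) + 1) ^ 2) := fun i => by
    have := hfm (N + i)
    rw [← lintegral_const_mul _ (by fun_prop)]
    refine lintegral_congr fun ψ => ?_
    rw [← one_div_mul_eq_div _ (f (N + i) ψ), ENNReal.ofReal_mul (by positivity)]
    ring
  simp_rw [e]
  rw [← lintegral_tsum]
  · refine setLIntegral_congr_fun measurableSet_Ioo fun ψ hψ => ?_
    rw [ENNReal.tsum_mul_left, tsum_ofReal_eq_of_telescoping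
      (K := fun n => K n ψ) (f := fun n => f n ψ / (2 * n + 1) ^ 2)
      (fun n => div_nonneg (hf n ψ hψ) (by positivity)) (fun n => hK n ψ) (hlim ψ hψ)]
  · intro i
    have := hfm (N + i)
    exact Measurable.aemeasurable (by fun_prop)

/-- Integrating (t^{j+1}/(j+1)!)' against cos^{2n+1} by parts produces (2n+1) cos^{2n} sin, and
cos^{2n} sin = tan · cos^{2n+1}. Restoring the power 2n+1 makes `cosKernel_one_sub_succ` applicable.
-/
theorem ofReal_cosKernel_div (j n : ℕ) :
    ENNReal.ofReal (cosKernel j (n + 1) 0 / (2 * n + 1)) =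
      ∫⁻ ψ in Set.Ioo 0 (π / 2), ENNReal.ofReal (sin ψ / cos ψ * (ψ ^ (j + 1) / (j + 1)!)) *
        ENNReal.ofReal (cos ψ ^ (2 * n + 1) / cosMoment n) := by
  have hF : ∀ x ∈ Set.uIcc 0 (π / 2),
      HasDerivAt (fun x => cos x ^ (2 * n + 1) * ((x - 0) ^ (j + 1) / ((j + 1)! : ℝ)))
        (cos x ^ (2 * n + 1) * ((x - 0) ^ j / (j ! : ℝ))
          - (2 * n + 1) * (cos x ^ (2 * n) * sin x * ((x - 0) ^ (j + 1) / ((j + 1)! : ℝ)))) x := by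
    intro x _
    refine (((hasDerivAt_cos x).pow (2 * n + 1)).mul
      (hasDerivAt_sub_pow_div_factorial j 0 x)).congr_deriv ?_
    simp only [Pi.pow_apply, Nat.add_sub_cancel]
    push_cast
    ring
  have h := intervalIntegral.integral_eq_sub_of_hasDerivAt hF
    (Continuous.intervalIntegrable (by fun_prop) _ _)
  rw [intervalIntegral.integral_sub (Continuous.intervalIntegrable (by fun_prop) _ _)
    (Continuous.intervalIntegrable (by fun_prop) _ _), intervalIntegral.integral_const_mul,
    cos_pi_div_two, zero_pow (by omega), sub_self, zero_pow (by omega), zero_div, mul_zero,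
    zero_mul, sub_self, sub_eq_zero] at h
  have hn : (2 * n + 1 : ℝ) ≠ 0 := by positivity
  have hw := cosMoment_pos n
  rw [cosKernel, h, div_div, mul_comm (cosMoment n), mul_div_mul_left _ _ hn,
    ← intervalIntegral.integral_div, intervalIntegral.integral_of_le (by positivity),
    integral_Ioc_eq_integral_Ioo, ofReal_integral_eq_lintegral_ofReal]
  · refine setLIntegral_congr_fun measurableSet_Ioo fun ψ hψ => ?_
    have hc : 0 < cos ψ := cos_pos_of_mem_Ioo ⟨by linarith [hψ.1, pi_pos], hψ.2⟩
    have hs : 0 < sin ψ := sin_pos_of_mem_Ioo ⟨hψ.1, by linarith [hψ.2, pi_pos]⟩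
    have hψ0 := hψ.1
    rw [← ENNReal.ofReal_mul (by positivity)]
    congr 1
    rw [sub_zero, pow_succ (cos ψ)]
    field_simp
  · exact ((Continuous.integrableOn_Icc (by fun_prop)).mono_set Set.Ioo_subset_Icc_self)
  · refine (ae_restrict_iff' measurableSet_Ioo).2 (Eventually.of_forall fun ψ hψ => ?_)
    have hc : 0 < cos ψ := cos_pos_of_mem_Ioo ⟨by linarith [hψ.1, pi_pos], hψ.2⟩
    have hs : 0 < sin ψ := sin_pos_of_mem_Ioo ⟨hψ.1, by linarith [hψ.2, pi_pos]⟩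
    have hψ0 := hψ.1
    simp only [sub_zero, Pi.zero_apply]
    positivity

theorem tailSum_three_twos (s N : ℕ) :
    tailSum (3 :: twos s) N = ∫⁻ ψ in Set.Ioo 0 (π / 2),
      ENNReal.ofReal (sin ψ / cos ψ * (ψ ^ (2 * s + 1) / (2 * s + 1)!)) *
        ENNReal.ofReal (cosKernel 1 N ψ) := by
  rw [← tsum_mul_lintegral_of_telescoping
    (f := fun n ψ => cos ψ ^ (2 * n + 1) / cosMoment n) (K := cosKernel 1) (by fun_prop)
    (fun n => by fun_prop) (fun n ψ hψ => ?_) cosKernel_one_sub_succ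
    (fun ψ hψ => tendsto_cosKernel 0 hψ.1.le hψ.2.le), tailSum]
  · refine tsum_congr fun i => ?_
    rw [← ofReal_cosKernel_div, tailSum_twos, ← ENNReal.ofReal_mul (by positivity),
      ← ENNReal.ofReal_mul (by positivity)]
    congr 1
    have : (2 * ((N + i : ℕ) : ℝ) + 1) ≠ 0 := by positivity
    field_simp
  · have hc : 0 < cos ψ := cos_pos_of_mem_Ioo ⟨by linarith [hψ.1, pi_pos], hψ.2⟩
    have hw := cosMoment_pos n
    positivity

theorem tailSum_twosThreeTwos (r s N : ℕ) :
    tailSum (twosThreeTwos r s) N = ∫⁻ ψ in Set.Ioo 0 (π / 2),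
      ENNReal.ofReal (sin ψ / cos ψ * (ψ ^ (2 * s + 1) / (2 * s + 1)!)) *
        ENNReal.ofReal (cosKernel (2 * r + 1) N ψ) := by
  induction r generalizing N with
  | zero => exact tailSum_three_twos s N
  | succ r ih =>
    rw [← tsum_mul_lintegral_of_telescoping
      (f := fun n ψ => cosKernel (2 * r + 1) (n + 1) ψ) (K := cosKernel (2 * (r + 1) + 1))
      (by fun_prop) (fun n => (continuous_cosKernel _ _).measurable)
      (fun n ψ hψ => cosKernel_nonneg _ _ hψ.1.le hψ.2.le)
      (fun n ψ => cosKernel_sub_succ (2 * r + 1) n ψ)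
      (fun ψ hψ => tendsto_cosKernel _ hψ.1.le hψ.2.le)]
    change tailSum (2 :: twosThreeTwos r s) N = _
    rw [tailSum]
    refine tsum_congr fun i => ?_
    rw [ih]

/-! ### Integrals of polynomials against the cotangent -/

open Polynomial in
theorem integral_eval_mul_sin_step (P : ℝ[X]) {k : ℕ} (hk : k ≠ 0) :
    ∫ u in (0 : ℝ)..π / 2, P.eval u * sin (2 * k * u) =
      (P.eval 0 - (-1) ^ k * P.eval (π / 2)) / (2 * k)
        - 1 / (2 * k) ^ 2 *
          ∫ u in (0 : ℝ)..π / 2, (derivative (derivative P)).eval u * sin (2 * k * u) := by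
  have hk' : (2 * k : ℝ) ≠ 0 := by positivity
  have hF : ∀ u ∈ Set.uIcc 0 (π / 2), HasDerivAt
      (fun u => -(P.eval u * cos (2 * k * u) / (2 * k))
        + (derivative P).eval u * sin (2 * k * u) / (2 * k) ^ 2)
      (P.eval u * sin (2 * k * u)
        + 1 / (2 * k) ^ 2 * ((derivative (derivative P)).eval u * sin (2 * k * u))) u := by
    intro u _
    have hl : HasDerivAt (fun u : ℝ => 2 * k * u) (2 * k) u := by
      simpa using (hasDerivAt_id u).const_mul (2 * (k : ℝ))
    refine ((((P.hasDerivAt u).mul hl.cos).div_const (2 * (k : ℝ))).neg.add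
      ((((derivative P).hasDerivAt u).mul hl.sin).div_const ((2 * (k : ℝ)) ^ 2))).congr_deriv ?_
    field_simp
    ring
  have h := intervalIntegral.integral_eq_sub_of_hasDerivAt hF
    (Continuous.intervalIntegrable (by fun_prop) _ _)
  rw [intervalIntegral.integral_add (Continuous.intervalIntegrable (by fun_prop) _ _)
    (Continuous.intervalIntegrable (by fun_prop) _ _), intervalIntegral.integral_const_mul,
    show 2 * (k : ℝ) * (π / 2) = k * π by ring, cos_nat_mul_pi, sin_nat_mul_pi, mul_zero,
    mul_zero, cos_zero, sin_zero] at h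
  rw [eq_sub_iff_add_eq, h]
  field_simp
  ring

open Polynomial in
theorem integral_eval_mul_sin (d : ℕ) (P : ℝ[X]) (hP : derivative^[2 * d] P = 0) {k : ℕ}
    (hk : k ≠ 0) :
    ∫ u in (0 : ℝ)..π / 2, P.eval u * sin (2 * k * u) =
      ∑ j ∈ Finset.range d, (-1) ^ j * ((derivative^[2 * j] P).eval 0
        - (-1) ^ k * (derivative^[2 * j] P).eval (π / 2)) / (2 * k) ^ (2 * j + 1) := by
  induction d generalizing P with
  | zero =>
    have : P = 0 := by simpa using hP
    simp [this]
  | succ d ih =>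
    have hit : ∀ j, derivative^[2 * j] (derivative (derivative P)) = derivative^[2 * (j + 1)] P :=
      fun j => by
        rw [show 2 * (j + 1) = 2 * j + 1 + 1 by ring, Function.iterate_succ_apply,
          Function.iterate_succ_apply]
    have hk' : (2 * k : ℝ) ≠ 0 := by positivity
    rw [integral_eval_mul_sin_step P hk, ih _ (by rw [hit]; exact hP), Finset.sum_range_succ',
      sub_eq_add_neg, add_comm, Finset.mul_sum, ← Finset.sum_neg_distrib]
    congr 1
    · refine Finset.sum_congr rfl fun j _ => ?_
      rw [hit, show 2 * (j + 1) + 1 = 2 * j + 1 + 2 by ring, pow_add _ _ 2, pow_succ (-1 : ℝ) j]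
      field_simp
      ring
    · simp

/-- Telescoping of 2 sin 2ku sin u = cos (2k-1)u - cos (2k+1)u. -/
theorem sum_two_mul_sin_mul_sin (n : ℕ) (u : ℝ) :
    (∑ k ∈ Finset.range n, 2 * sin (2 * ((k + 1 : ℕ) : ℝ) * u)) * sin u
      = cos u - cos ((2 * n + 1) * u) := by
  induction n with
  | zero => simp
  | succ n ih =>
    rw [Finset.sum_range_succ, add_mul, ih]
    have h1 : (2 * (n : ℝ) + 1) * u = 2 * ((n + 1 : ℕ) : ℝ) * u - u := by push_cast; ring
    have h2 : (2 * ((n + 1 : ℕ) : ℝ) + 1) * u = 2 * ((n + 1 : ℕ) : ℝ) * u + u := by ring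
    rw [h1, h2, cos_sub, cos_add]
    ring

-- The zero of P at 0 cancels that of the sine: P = X R gives P/sin = R/sinc, continuous on the
-- closed interval.
open Polynomial in
theorem intervalIntegrable_eval_div_sin {P : ℝ[X]} (hP : P.eval 0 = 0) :
    IntervalIntegrable (fun u => P.eval u / sin u) volume 0 (π / 2) := by
  obtain ⟨R, rfl⟩ : X ∣ P := by rwa [X_dvd_iff, coeff_zero_eq_eval_zero]
  have hpi : (0 : ℝ) ≤ π / 2 := by positivity
  have hc : IntervalIntegrable (fun u => R.eval u / sinc u) volume 0 (π / 2) := by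
    refine ContinuousOn.intervalIntegrable ?_
    rw [Set.uIcc_of_le hpi]
    refine ContinuousOn.div (by fun_prop) continuous_sinc.continuousOn fun u hu => ?_
    rcases eq_or_lt_of_le hu.1 with h | h
    · simp [← h]
    · rw [sinc_of_ne_zero h.ne']
      exact (div_pos (sin_pos_of_mem_Ioo ⟨h, by linarith [hu.2, pi_pos]⟩) h).ne'
  refine hc.congr fun u hu => ?_
  rw [Set.uIoc_of_le hpi] at hu
  have := hu.1.ne'
  simp only [eval_mul, eval_X]
  rw [sinc_of_ne_zero this, div_div_eq_mul_div, mul_comm]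

/-- Riemann–Lebesgue for g extended by zero; the frequency is (2n+1)/(2π) in the normalisation of
`Real.fourierChar`, and the real part gives the cosine. -/
theorem tendsto_integral_mul_cos {g : ℝ → ℝ} (hg : IntervalIntegrable g volume 0 (π / 2)) :
    Tendsto (fun n : ℕ => ∫ u in (0 : ℝ)..π / 2, g u * cos ((2 * n + 1) * u)) atTop (𝓝 0) := by
  have hpi : (0 : ℝ) ≤ π / 2 := by positivity
  let f : ℝ → ℂ := (Set.Ioc 0 (π / 2)).indicator fun u => (g u : ℂ)
  have hf : Integrable f := by
    have := ((intervalIntegrable_iff_integrableOn_Ioc_of_le hpi).1 hg)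
    exact (integrable_indicator_iff measurableSet_Ioc).2 this.ofReal
  have hw : Tendsto (fun n : ℕ => (2 * (n : ℝ) + 1) / (2 * π)) atTop (cocompact ℝ) := by
    refine Tendsto.mono_right ?_ atTop_le_cocompact
    refine Tendsto.atTop_div_const (by positivity) ?_
    exact tendsto_atTop_add_const_right _ _
      (tendsto_natCast_atTop_atTop.const_mul_atTop (by norm_num))
  have h := (Complex.continuous_re.tendsto 0).comp
    ((Real.tendsto_integral_exp_smul_cocompact f).comp hw)
  rw [Complex.zero_re] at h
  refine h.congr fun n => ?_
  simp only [Function.comp_apply]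
  have hint : Integrable fun v => Real.fourierChar (-(v * ((2 * n + 1) / (2 * π)))) • f v := by
    refine hf.mono ?_ (Eventually.of_forall fun v => by simp)
    refine AEStronglyMeasurable.smul ?_ hf.aestronglyMeasurable
    exact Continuous.aestronglyMeasurable (by fun_prop)
  rw [← Complex.reCLM_apply, ← ContinuousLinearMap.integral_comp_comm _ hint,
    intervalIntegral.integral_of_le hpi, ← integral_indicator measurableSet_Ioc]
  refine integral_congr_ae (Eventually.of_forall fun v => ?_)
  simp only [Complex.reCLM_apply, f, Set.indicator_apply]
  split_ifs
  · rw [Circle.smul_def, Real.fourierChar_apply, smul_eq_mul, Complex.re_mul_ofReal,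
      show ((2 * π * -(v * ((2 * n + 1) / (2 * π))) : ℝ) : ℂ) =
        ((-((2 * n + 1) * v) : ℝ) : ℂ) by congr 1; field_simp,
      Complex.exp_ofReal_mul_I_re, cos_neg, mul_comm]
  · simp

-- The n-th partial sum differs from the limit by ∫ (P/sin) cos((2n+1)u), which tends to 0.
open Polynomial in
theorem tendsto_sum_integral_eval_mul_sin {P : ℝ[X]} (hP : P.eval 0 = 0) :
    Tendsto (fun n : ℕ => ∑ k ∈ Finset.range n,
        2 * ∫ u in (0 : ℝ)..π / 2, P.eval u * sin (2 * ((k + 1 : ℕ) : ℝ) * u))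
      atTop (𝓝 (∫ u in (0 : ℝ)..π / 2, P.eval u / sin u * cos u)) := by
  have hg := intervalIntegrable_eval_div_sin hP
  have hlim := (tendsto_integral_mul_cos hg).const_sub
    (∫ u in (0 : ℝ)..π / 2, P.eval u / sin u * cos u)
  rw [sub_zero] at hlim
  refine hlim.congr fun n => ?_
  simp_rw [← intervalIntegral.integral_const_mul]
  rw [← intervalIntegral.integral_finsetSum, ← intervalIntegral.integral_sub]
  · refine intervalIntegral.integral_congr fun u hu => ?_
    have hpi : (0 : ℝ) ≤ π / 2 := by positivity
    rw [Set.uIcc_of_le hpi] at hu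
    rw [← mul_sub, ← sum_two_mul_sin_mul_sin]
    rcases eq_or_lt_of_le hu.1 with h | h
    · simp [← h, hP]
    · have hs : sin u ≠ 0 := (sin_pos_of_mem_Ioo ⟨h, by linarith [hu.2, pi_pos]⟩).ne'
      rw [mul_comm _ (sin u), ← mul_assoc, div_mul_cancel₀ _ hs, Finset.mul_sum]
      exact Finset.sum_congr rfl fun k _ => by ring
  · exact hg.mul_continuousOn (by fun_prop)
  · exact hg.mul_continuousOn (by fun_prop)
  · exact fun k _ => Continuous.intervalIntegrable (by fun_prop) _ _

/-! ### Zeta values -/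

theorem summable_one_div_succ_pow {p : ℕ} (hp : 1 < p) :
    Summable fun k : ℕ => 1 / ((k : ℝ) + 1) ^ p := by
  have := (summable_nat_add_iff 1).2 (Real.summable_one_div_nat_pow.2 hp)
  simpa using this

theorem ofReal_tsum_one_div_succ_pow {p : ℕ} (hp : 1 < p) :
    ((∑' k : ℕ, 1 / ((k : ℝ) + 1) ^ p : ℝ) : ℂ) = riemannZeta p := by
  rw [zeta_nat_eq_tsum_of_gt_one hp]
  have h := (Real.summable_one_div_nat_pow.2 hp).tsum_eq_zero_add
  have h0 : p ≠ 0 := by omega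
  simp only [Nat.cast_zero, zero_pow h0, div_zero, zero_add, Nat.cast_add, Nat.cast_one] at h
  rw [← h, Complex.ofReal_tsum]
  push_cast
  rfl

/-- Because of the shift k + 1, odd k correspond to even integers; they contribute 2^{-p} Z and
carry the minus sign. -/
theorem hasSum_alternating_one_div_succ_pow {p : ℕ} (hp : 1 < p) :
    HasSum (fun k : ℕ => (-1) ^ k / ((k : ℝ) + 1) ^ p)
      ((1 - 2 / 2 ^ p) * ∑' k : ℕ, 1 / ((k : ℝ) + 1) ^ p) := by
  set Z := ∑' k : ℕ, 1 / ((k : ℝ) + 1) ^ p with hZ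
  have hs := summable_one_div_succ_pow hp
  have hodd : HasSum (fun k : ℕ => 1 / (((2 * k + 1 : ℕ) : ℝ) + 1) ^ p) (1 / 2 ^ p * Z) := by
    refine (hs.hasSum.mul_left (1 / 2 ^ p)).congr_fun ?_
    intro k
    rw [div_mul_div_comm, ← mul_pow]
    push_cast
    congr 2 <;> ring
  have heven : Summable (fun k : ℕ => 1 / (((2 * k : ℕ) : ℝ) + 1) ^ p) :=
    hs.comp_injective (i := fun k => 2 * k) fun a b h => by simpa using h
  have hE := (HasSum.even_add_odd (f := fun k : ℕ => 1 / ((k : ℝ) + 1) ^ p)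
    heven.hasSum hodd).unique hs.hasSum
  have := HasSum.even_add_odd (f := fun k : ℕ => (-1) ^ k / ((k : ℝ) + 1) ^ p)
    (m := ∑' k : ℕ, 1 / (((2 * k : ℕ) : ℝ) + 1) ^ p) (m' := -(1 / 2 ^ p * Z))
    (by simpa using heven.hasSum) (by
      refine hodd.neg.congr_fun ?_
      intro k
      rw [pow_succ, pow_mul]
      simp [neg_div])
  convert this using 1
  rw [← hZ] at hE
  linear_combination -hE

open Polynomial in
theorem integral_eval_div_sin_mul_cos {d : ℕ} {P : ℝ[X]} (hP : derivative^[2 * (d + 1)] P = 0)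
    (h0 : P.eval 0 = 0) (h1 : P.eval (π / 2) = 0) :
    ∫ u in (0 : ℝ)..π / 2, P.eval u / sin u * cos u =
      ∑ j ∈ Finset.Icc 1 d, (-1) ^ j / 2 ^ (2 * j) * ((derivative^[2 * j] P).eval 0
        + (1 - 1 / 2 ^ (2 * j)) * (derivative^[2 * j] P).eval (π / 2))
        * ∑' k : ℕ, 1 / ((k : ℝ) + 1) ^ (2 * j + 1) := by
  have hsum : HasSum (fun k : ℕ => ∑ j ∈ Finset.Icc 1 d,
      ((-1) ^ j / 2 ^ (2 * j) * (derivative^[2 * j] P).eval 0 * (1 / ((k : ℝ) + 1) ^ (2 * j + 1))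
        + (-1) ^ j / 2 ^ (2 * j) * (derivative^[2 * j] P).eval (π / 2) *
          ((-1) ^ k / ((k : ℝ) + 1) ^ (2 * j + 1))))
      (∑ j ∈ Finset.Icc 1 d, (-1) ^ j / 2 ^ (2 * j) * ((derivative^[2 * j] P).eval 0
        + (1 - 1 / 2 ^ (2 * j)) * (derivative^[2 * j] P).eval (π / 2))
        * ∑' k : ℕ, 1 / ((k : ℝ) + 1) ^ (2 * j + 1)) := by
    refine hasSum_sum fun j hj => ?_
    have hp : 1 < 2 * j + 1 := by have := (Finset.mem_Icc.1 hj).1; omega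
    have hs := ((summable_one_div_succ_pow hp).hasSum.mul_left
      ((-1) ^ j / 2 ^ (2 * j) * (derivative^[2 * j] P).eval 0)).add
      ((hasSum_alternating_one_div_succ_pow hp).mul_left
      ((-1) ^ j / 2 ^ (2 * j) * (derivative^[2 * j] P).eval (π / 2)))
    have : (2 : ℝ) / 2 ^ (2 * j + 1) = 1 / 2 ^ (2 * j) := by
      rw [pow_succ]; field_simp
    rw [this] at hs
    rwa [mul_add, add_mul, ← mul_assoc, mul_right_comm _ (1 - 1 / 2 ^ (2 * j) : ℝ),
      mul_assoc _ (1 - 1 / 2 ^ (2 * j) : ℝ)]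
  refine tendsto_nhds_unique (tendsto_sum_integral_eval_mul_sin h0) ?_
  refine hsum.tendsto_sum_nat.congr fun n => Finset.sum_congr rfl fun k _ => ?_
  rw [integral_eval_mul_sin (d + 1) P hP k.succ_ne_zero, Finset.range_eq_Ico,
    Finset.sum_eq_sum_Ico_succ_bot (by omega)]
  -- The j = 0 term, which would be a harmonic series, disappears because P vanishes at both
  -- endpoints.
  have e0 : derivative^[2 * 0] P = P := rfl
  rw [e0, h0, h1, mul_zero, sub_zero, mul_zero, zero_div, zero_add, Finset.mul_sum]
  refine Finset.sum_congr rfl fun j _ => ?_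
  push_cast
  have hk : (k : ℝ) + 1 ≠ 0 := by positivity
  rw [mul_pow, pow_succ (2 : ℝ) (2 * j), pow_succ (-1 : ℝ) k]
  field_simp
  ring

/-! ### The beta polynomials -/

open Polynomial in
/-- The polynomial `u ^ a / a! * (c - u) ^ b / b!`. -/
noncomputable def betaPoly (c : ℝ) (a b : ℕ) : ℝ[X] :=
  C (1 / ((a ! : ℝ) * b !)) * (X ^ a * (C c - X) ^ b)

open Polynomial in
theorem eval_betaPoly (c : ℝ) (a b : ℕ) (u : ℝ) :
    (betaPoly c a b).eval u = u ^ a / a ! * ((c - u) ^ b / b !) := by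
  simp only [betaPoly, eval_mul, eval_C, eval_pow, eval_X, eval_sub]
  field_simp

open Polynomial in
theorem natDegree_betaPoly_le (c : ℝ) (a b : ℕ) : (betaPoly c a b).natDegree ≤ a + b := by
  have h : (C c - X : ℝ[X]).natDegree ≤ 1 := by compute_degree
  refine (natDegree_C_mul_le _ _).trans (natDegree_mul_le.trans (add_le_add ?_ ?_))
  · exact natDegree_X_pow_le a
  · simpa using natDegree_pow_le_of_le b h

-- The derivative at 0 is (2j)! times a coefficient. The sign is that of (c - X)^{2s+1} = -(X -
-- c)^{2s+1}; the remaining power of -c is even.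
open Polynomial in
theorem iterate_derivative_betaPoly_eval_zero (c : ℝ) {r s j : ℕ} (hj : j ≤ r + s + 1) :
    (derivative^[2 * j] (betaPoly c (2 * r + 1) (2 * s + 1))).eval 0 =
      -((2 * j).choose (2 * r + 1) *
        (c ^ (2 * (r + s + 1 - j)) / (2 * (r + s + 1 - j))!)) := by
  have hodd : Odd (2 * s + 1) := ⟨s, rfl⟩
  rw [← coeff_zero_eq_eval_zero, coeff_iterate_derivative, zero_add, Nat.descFactorial_self,
    betaPoly, coeff_C_mul, coeff_X_pow_mul', ← neg_sub, hodd.neg_pow, coeff_neg,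
    sub_eq_add_neg, ← C_neg, coeff_X_add_C_pow, nsmul_eq_mul]
  split_ifs with h
  · obtain ⟨i, hi⟩ := Nat.exists_eq_add_of_le h
    obtain ⟨e, he⟩ : ∃ e, e = r + s + 1 - j := ⟨_, rfl⟩
    have hb : 2 * s + 1 = i + 2 * e := by omega
    rw [← he, hi, Nat.add_sub_cancel_left, hb, Nat.add_sub_cancel_left, Nat.cast_add_choose,
      Nat.cast_add_choose, Even.neg_pow ⟨e, two_mul e⟩]
    have h1 : ((i + 2 * e)! : ℝ) ≠ 0 := by positivity
    have h2 : ((2 * r + 1)! : ℝ) ≠ 0 := by positivity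
    have h3 : (i ! : ℝ) ≠ 0 := by positivity
    have h4 : ((2 * e)! : ℝ) ≠ 0 := by positivity
    field_simp
  · rw [Nat.choose_eq_zero_of_lt (by omega)]
    simp

-- An even number of derivatives cancels the chain-rule signs.
open Polynomial in
theorem iterate_derivative_comp_C_sub_X (c : ℝ) (j : ℕ) (P : ℝ[X]) :
    derivative^[2 * j] (P.comp (C c - X)) = (derivative^[2 * j] P).comp (C c - X) := by
  induction j generalizing P with
  | zero => rfl
  | succ j ih =>
    have h : derivative (derivative (P.comp (C c - X)))
        = (derivative (derivative P)).comp (C c - X) := by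
      simp [derivative_comp]
    rw [show 2 * (j + 1) = 2 * j + 1 + 1 by ring]
    simp only [Function.iterate_succ_apply]
    rw [h, ih]

-- The reflection u ↦ c - u exchanges the two exponents and the two endpoints.
open Polynomial in
theorem iterate_derivative_betaPoly_eval (c : ℝ) {r s j : ℕ} (hj : j ≤ r + s + 1) :
    (derivative^[2 * j] (betaPoly c (2 * r + 1) (2 * s + 1))).eval c =
      -((2 * j).choose (2 * s + 1) *
        (c ^ (2 * (r + s + 1 - j)) / (2 * (r + s + 1 - j))!)) := by
  have h : betaPoly c (2 * r + 1) (2 * s + 1)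
      = (betaPoly c (2 * s + 1) (2 * r + 1)).comp (C c - X) := by
    simp only [betaPoly, mul_comp, C_comp, pow_comp, X_comp, sub_comp, sub_sub_cancel]
    rw [mul_comm ((2 * s + 1)! : ℝ), mul_comm (X ^ _)]
  rw [h, iterate_derivative_comp_C_sub_X, eval_comp, eval_sub, eval_C, eval_X, sub_self,
    iterate_derivative_betaPoly_eval_zero c (by omega), add_comm r s]

/-! ### The cotangent integral and the final formula -/

theorem tailSum_twosThreeTwos_zero (r s : ℕ) :
    0 ≤ (∫ u in (0 : ℝ)..π / 2, (betaPoly (π / 2) (2 * r + 1) (2 * s + 1)).eval u / sin u * cos u) ∧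
    tailSum (twosThreeTwos r s) 0 = ENNReal.ofReal
      (∫ u in (0 : ℝ)..π / 2,
        (betaPoly (π / 2) (2 * r + 1) (2 * s + 1)).eval u / sin u * cos u) := by
  have hpi : (0 : ℝ) ≤ π / 2 := by positivity
  set F : ℝ → ℝ := fun u =>
    (betaPoly (π / 2) (2 * r + 1) (2 * s + 1)).eval u / sin u * cos u with hFdef
  have hF : IntervalIntegrable F volume 0 (π / 2) :=
    (intervalIntegrable_eval_div_sin (by simp [eval_betaPoly])).mul_continuousOn
      continuous_cos.continuousOn
  have hF' : IntervalIntegrable (fun x => F (π / 2 - x)) volume 0 (π / 2) := by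
    simpa using (hF.comp_sub_left (π / 2)).symm
  have hsub : ∫ u in (0 : ℝ)..π / 2, F u = ∫ x in (0 : ℝ)..π / 2, F (π / 2 - x) := by
    rw [intervalIntegral.integral_comp_sub_left F (π / 2), sub_self, sub_zero]
  have hval : ∀ x, F (π / 2 - x) = sin x / cos x * (x ^ (2 * s + 1) / (2 * s + 1)!) *
      ((π / 2 - x) ^ (2 * r + 1) / (2 * r + 1)!) := fun x => by
    simp only [hFdef, eval_betaPoly, sin_pi_div_two_sub, cos_pi_div_two_sub, sub_sub_cancel]
    ring
  have hnn : ∀ x ∈ Set.Ioo 0 (π / 2), 0 ≤ sin x / cos x * (x ^ (2 * s + 1) / (2 * s + 1)!) :=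
    fun x hx => by
      have hc : 0 < cos x := cos_pos_of_mem_Ioo ⟨by linarith [hx.1, pi_pos], hx.2⟩
      have hs : 0 < sin x := sin_pos_of_mem_Ioo ⟨hx.1, by linarith [hx.2, pi_pos]⟩
      have := hx.1
      positivity
  have hnn' : ∀ x ∈ Set.Ioo 0 (π / 2), 0 ≤ F (π / 2 - x) := fun x hx => by
    rw [hval]
    have : 0 ≤ π / 2 - x := by linarith [hx.2]
    exact mul_nonneg (hnn x hx) (by positivity)
  rw [hsub, intervalIntegral.integral_of_le hpi, integral_Ioc_eq_integral_Ioo]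
  refine ⟨setIntegral_nonneg measurableSet_Ioo hnn', ?_⟩
  rw [ofReal_integral_eq_lintegral_ofReal, tailSum_twosThreeTwos]
  · refine setLIntegral_congr_fun measurableSet_Ioo fun x hx => ?_
    rw [hval, ENNReal.ofReal_mul (hnn x hx), cosKernel]
  · exact ((intervalIntegrable_iff_integrableOn_Ioc_of_le hpi).1 hF').mono_set
      Set.Ioo_subset_Ioc_self
  · exact (ae_restrict_iff' measurableSet_Ioo).2 (Eventually.of_forall hnn')

theorem theorem1p2 (r s : ℕ) :
    Summable (tTerm (twosThreeTwos r s)) ∧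
    (∀ k ∈ Finset.Icc 1 (r + s + 1), Summable (tTerm (twos (r + s + 1 - k)))) ∧
    (T r s : ℂ) =
      ∑ k ∈ Finset.Icc 1 (r + s + 1),
        (-1 : ℂ) ^ (k - 1) * (dCoeff k r s : ℂ) * (1 / 2 ^ (2 * k))
          * riemannZeta (2 * (k : ℂ) + 1) * (multipleT (twos (r + s + 1 - k)) : ℂ) := by
  obtain ⟨hnn, htail⟩ := tailSum_twosThreeTwos_zero r s
  obtain ⟨hsum, hT⟩ := summable_tTerm_and_multipleT_eq hnn htail
  refine ⟨hsum, fun k _ => (multipleT_twos _).1, ?_⟩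
  have hdeg := natDegree_betaPoly_le (π / 2) (2 * r + 1) (2 * s + 1)
  rw [T, hT, integral_eval_div_sin_mul_cos (d := r + s + 1)
    (Polynomial.iterate_derivative_eq_zero (by omega)) (by simp [eval_betaPoly])
    (by simp [eval_betaPoly]), Complex.ofReal_sum]
  refine Finset.sum_congr rfl fun k hk => ?_
  obtain ⟨hk1, hk2⟩ := Finset.mem_Icc.1 hk
  have hz := ofReal_tsum_one_div_succ_pow (p := 2 * k + 1) (by omega)
  rw [show ((2 * k + 1 : ℕ) : ℂ) = 2 * (k : ℂ) + 1 by push_cast; ring] at hz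
  rw [iterate_derivative_betaPoly_eval_zero _ hk2, iterate_derivative_betaPoly_eval _ hk2,
    (multipleT_twos _).2, Complex.ofReal_mul, hz, dCoeff]
  -- Writing k = m + 1 removes the truncated subtraction; the minus sign of the derivative values
  -- turns (-1)^k into (-1)^(k-1).
  obtain ⟨m, rfl⟩ : ∃ m, k = m + 1 := ⟨k - 1, by omega⟩
  rw [Nat.add_sub_cancel, pow_succ (-1 : ℝ) m]
  push_cast
  ring
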